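/- Let $A$ and $\Omega$ be Polish spaces, $\mu$ a Borel probability measure on $\Omega$, $\nu$ a Borel probability measure on $A$, $\lambda>0$, and let $u:A\times\Omega\to(-\infty,\overline u]$ be Borel measurable, where $\overline u\in\mathbb R$. Let $a_\nu:A\to[-\infty,\infty]$ and $b_\nu:\Omega\to[-\infty,\infty]$ be measurable functions, finite $\nu$-a.e. and $\mu$-a.e. respectively, that satisfy the Schrödinger equations exactly, at every point: $$e^{a_\nu(\alpha)}=\int e^{\frac{u(\alpha,\omega)}{\lambda}-b_\nu(\omega)}\,d\mu(\omega)\quad\text{for every }\alpha\in A,\qquad e^{b_\nu(\omega)}=\int e^{\frac{u(\alpha,\omega)}{\lambda}-a_\nu(\alpha)}\,d\nu(\alpha)\quad\text{for every }\omega\in\Omega .$$ Suppose that $a_\nu$ is $\nu$-integrable and normalized so that $E_\nu[a_\nu]=\int a_\nu\,d\nu=0$. Then the Kuhn–Tucker condition (of Caplin, Dean and Leahy) $$\int\left(\frac{e^{u(\alpha,\omega)/\lambda}}{\int e^{u(\alpha',\omega)/\lambda}\,d\nu(\alpha')}-1\right)d\mu(\omega)\le 0\quad\text{for every }\alpha\in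 A,\text{ with equality for }\nu\text{-a.e. }\alpha,$$ holds if and only if $$a_\nu(\alpha)\le 0\quad\text{for every }\alpha\in A,\text{ with equality for }\nu\text{-a.e. }\alpha .$$ Moreover, the latter condition holds if and only if $a_\nu$ is a plateau function with respect to $\nu$, that is, $\nu(\{\alpha: a_\nu(\alpha)=\operatorname{ess\,sup}_\nu a_\nu\})=\nu(A)$ and $a_\nu(\alpha)\le\operatorname{ess\,sup}_\nu a_\nu$ for every $\alpha\in A$. -/

import Mathlib

open MeasureTheory

noncomputable section

namespace RationalInattention

variable {A Ω : Type*} [MeasurableSpace A] [MeasurableSpace Ω]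

/-- The partition function `Z(ω; ν) = ∫ exp (u(α, ω) / lam) dν(α)`; for a finite action set this is
the sum `∑ α, exp (u(α, ω) / lam) * ν {α}`. -/
def partitionFunction (u : A → Ω → ℝ) (lam : ℝ) (ν : Measure A) (ω : Ω) : ℝ :=
  ∫ α, Real.exp (u α ω / lam) ∂ν

/-- The integrand `exp (u(α, ω) / lam) / Z(ω; ν) - 1` of the Kuhn-Tucker condition. -/
def kuhnTuckerIntegrand (u : A → Ω → ℝ) (lam : ℝ) (ν : Measure A) (α : A) (ω : Ω) : ℝ :=
  Real.exp (u α ω / lam) / partitionFunction u lam ν ω - 1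

/-- The Kuhn-Tucker condition: `∫ (exp (u(α, ω) / lam) / Z(ω; ν) - 1) dμ(ω) ≤ 0` for every `α`, with
equality for `ν`-almost every `α`. The integrand is at least `-1`, so its integral always makes
sense in `(-∞, ∞]`; being at most `0` includes being finite, that is, integrability. -/
def KuhnTucker (u : A → Ω → ℝ) (lam : ℝ) (ν : Measure A) (μ : Measure Ω) : Prop :=
  (∀ α, Integrable (kuhnTuckerIntegrand u lam ν α) μ ∧
      ∫ ω, kuhnTuckerIntegrand u lam ν α ω ∂μ ≤ 0) ∧
    ∀ᵐ α ∂ν, ∫ ω, kuhnTuckerIntegrand u lam ν α ω ∂μ = 0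

/-- `a` and `b` are Schrödinger potentials for `ν` and `μ` in the exact sense: both Schrödinger
equations hold at every point. The potentials are finite almost everywhere; since the
equations are imposed everywhere, infinite values are allowed on null sets, where the integral
that defines the potential may diverge. -/
structure IsSchrodingerPotentials (u : A → Ω → ℝ) (lam : ℝ) (ν : Measure A) (μ : Measure Ω)
    (a : A → EReal) (b : Ω → EReal) : Prop where
  measurable_action : Measurable a
  measurable_state : Measurable b
  finite_action : ∀ᵐ α ∂ν, a α ≠ ⊥ ∧ a α ≠ ⊤
  finite_state : ∀ᵐ ω ∂μ, b ω ≠ ⊥ ∧ b ω ≠ ⊤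
  action_eq : ∀ α, EReal.exp (a α) = ∫⁻ ω, EReal.exp (((u α ω / lam : ℝ) : EReal) - b ω) ∂μ
  state_eq : ∀ ω, EReal.exp (b ω) = ∫⁻ α, EReal.exp (((u α ω / lam : ℝ) : EReal) - a α) ∂ν

/-- `a ≤ 0` everywhere, with equality `ν`-almost everywhere. -/
def NonposWithEqualityAE (a : A → EReal) (ν : Measure A) : Prop :=
  (∀ α, a α ≤ 0) ∧ ∀ᵐ α ∂ν, a α = 0

/-- `g` is a plateau with respect to `m`: it equals its `m`-essential supremum on a set of full
measure, and is nowhere larger. -/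
def IsPlateau (g : A → EReal) (m : Measure A) : Prop :=
  m {x | g x = essSup g m} = m Set.univ ∧ ∀ x, g x ≤ essSup g m

end RationalInattention

end

namespace RationalInattention

/-! If `a = 0` a.e., the state equation gives `exp b = Z` everywhere, and the action equation turns
`exp (a α)` into the Kuhn-Tucker integral at every `α` (`exp_action_of_ae_eq_zero`). It remains to
get `a = 0` a.e. from Kuhn-Tucker. Its equality part makes `q = exp (u / lam) / Z` the density of a
coupling of `ν` and `μ`; the Schrödinger equations do the same for `p = exp (u / lam - a - b)`.
Since `p / q` is `H(ω) / G(α)` with `G = exp a` and `H = Z / exp b`, uniqueness of such couplings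
(`ae_eq_of_coupling_densities`) gives `G(α) = H(ω)` a.e., so `a` is a.e. constant, and the
normalization makes the constant zero. -/

lemma exp_coe_sub (x : ℝ) (y : EReal) :
    EReal.exp ((x : EReal) - y) = ENNReal.ofReal (Real.exp x) * (EReal.exp y)⁻¹ := by
  rw [sub_eq_add_neg, EReal.exp_add, EReal.exp_neg, EReal.exp_coe]

lemma exp_eq_ofReal_toReal {y : EReal} (hy : y ≠ ⊥ ∧ y ≠ ⊤) :
    0 < (EReal.exp y).toReal ∧ EReal.exp y = ENNReal.ofReal (EReal.exp y).toReal := by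
  have h0 : EReal.exp y ≠ 0 := by simpa using hy.1
  have h1 : EReal.exp y ≠ ⊤ := by simpa using hy.2
  exact ⟨ENNReal.toReal_pos h0 h1, (ENNReal.ofReal_toReal h1).symm⟩

/-! ### Uniqueness of couplings with a product-form density ratio. -/

section Coupling

variable {A Ω : Type*} [MeasurableSpace A] [MeasurableSpace Ω] {ν : Measure A} {μ : Measure Ω}
  [IsProbabilityMeasure ν] [IsProbabilityMeasure μ]

lemma integrable_of_lintegral_fst_eq_one {p : A × Ω → ℝ} (hp : Measurable p) (hp0 : ∀ z, 0 ≤ p z)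
    (hpν : ∀ᵐ α ∂ν, ∫⁻ ω, ENNReal.ofReal (p (α, ω)) ∂μ = 1) : Integrable p (ν.prod μ) := by
  refine ⟨hp.aestronglyMeasurable, ?_⟩
  rw [hasFiniteIntegral_iff_ofReal (Filter.Eventually.of_forall hp0),
    lintegral_prod _ hp.ennreal_ofReal.aemeasurable, lintegral_congr_ae hpν]
  simp

/-- Bounded functions of the first coordinate integrate against a joint density as they do
against the first marginal. -/
lemma integral_comp_fst_mul_of_lintegral_eq_one {p : A × Ω → ℝ} (hp : Measurable p)
    (hp0 : ∀ z, 0 ≤ p z) (hpν : ∀ᵐ α ∂ν, ∫⁻ ω, ENNReal.ofReal (p (α, ω)) ∂μ = 1)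
    {f : A → ℝ} (hf : Measurable f) (hf1 : ∀ α, ‖f α‖ ≤ 1) :
    Integrable (fun z : A × Ω => f z.1 * p z) (ν.prod μ) ∧
      ∫ z, f z.1 * p z ∂(ν.prod μ) = ∫ α, f α ∂ν := by
  have hint : Integrable (fun z : A × Ω => f z.1 * p z) (ν.prod μ) :=
    (integrable_of_lintegral_fst_eq_one hp hp0 hpν).bdd_mul
      (hf.comp measurable_fst).aestronglyMeasurable (Filter.Eventually.of_forall fun z => hf1 z.1)
  refine ⟨hint, ?_⟩
  rw [integral_prod _ hint]
  refine integral_congr_ae ?_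
  filter_upwards [hpν] with α hα
  have h1 : ∫ ω, p (α, ω) ∂μ = 1 := by
    rw [integral_eq_lintegral_of_nonneg_ae (Filter.Eventually.of_forall fun ω => hp0 _)
      (hp.comp measurable_prodMk_left).aestronglyMeasurable, hα, ENNReal.toReal_one]
  simp only [integral_const_mul, h1, mul_one]

lemma integral_comp_snd_mul_of_lintegral_eq_one {p : A × Ω → ℝ} (hp : Measurable p)
    (hp0 : ∀ z, 0 ≤ p z) (hpμ : ∀ᵐ ω ∂μ, ∫⁻ α, ENNReal.ofReal (p (α, ω)) ∂ν = 1)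
    {g : Ω → ℝ} (hg : Measurable g) (hg1 : ∀ ω, ‖g ω‖ ≤ 1) :
    Integrable (fun z : A × Ω => g z.2 * p z) (ν.prod μ) ∧
      ∫ z, g z.2 * p z ∂(ν.prod μ) = ∫ ω, g ω ∂μ := by
  obtain ⟨h1, h2⟩ := integral_comp_fst_mul_of_lintegral_eq_one (ν := μ) (μ := ν)
    (p := fun z => p z.swap) (hp.comp measurable_swap) (fun z => hp0 _) hpμ hg hg1
  refine ⟨h1.swap, ?_⟩
  rw [← h2, ← integral_prod_swap]
  rfl

/-- Two couplings whose densities differ by a factor `H(ω) / G(α)` are equal. -/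
lemma ae_eq_of_coupling_densities {p q : A × Ω → ℝ} {G : A → ℝ} {H : Ω → ℝ}
    (hq : Measurable q) (hq0 : ∀ z, 0 < q z) (hG : Measurable G) (hH : Measurable H)
    (hG0 : ∀ α, 0 ≤ G α) (hH0 : ∀ ω, 0 ≤ H ω) (hGpos : ∀ᵐ α ∂ν, 0 < G α)
    (hp : ∀ z, p z = q z * (H z.2 / G z.1))
    (hpν : ∀ᵐ α ∂ν, ∫⁻ ω, ENNReal.ofReal (p (α, ω)) ∂μ = 1)
    (hpμ : ∀ᵐ ω ∂μ, ∫⁻ α, ENNReal.ofReal (p (α, ω)) ∂ν = 1)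
    (hqν : ∀ᵐ α ∂ν, ∫⁻ ω, ENNReal.ofReal (q (α, ω)) ∂μ = 1)
    (hqμ : ∀ᵐ ω ∂μ, ∫⁻ α, ENNReal.ofReal (q (α, ω)) ∂ν = 1) :
    ∀ᵐ z ∂(ν.prod μ), G z.1 = H z.2 := by
  have hpm : Measurable p := by
    rw [funext hp]
    exact hq.mul ((hH.comp measurable_snd).div (hG.comp measurable_fst))
  have hp0 : ∀ z, 0 ≤ p z := fun z => by
    rw [hp]; exact mul_nonneg (hq0 z).le (div_nonneg (hH0 _) (hG0 _))
  have hbdd : ∀ x : ℝ, 0 ≤ x → ‖x / (1 + x)‖ ≤ 1 := fun x hx => by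
    rw [Real.norm_of_nonneg (by positivity), div_le_one (by positivity)]; linarith
  -- The increasing map `φ x = x / (1 + x)` is bounded on `[0, ∞)`, so no integrability of `G` or
  -- `H` is needed.
  have hf : Measurable fun α => G α / (1 + G α) := by fun_prop
  have hg : Measurable fun ω => H ω / (1 + H ω) := by fun_prop
  obtain ⟨i1, e1⟩ := integral_comp_fst_mul_of_lintegral_eq_one hpm hp0 hpν hf
    fun α => hbdd _ (hG0 α)
  obtain ⟨i2, e2⟩ := integral_comp_snd_mul_of_lintegral_eq_one hpm hp0 hpμ hg
    fun ω => hbdd _ (hH0 ω)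
  obtain ⟨i3, e3⟩ := integral_comp_fst_mul_of_lintegral_eq_one hq (fun z => (hq0 z).le) hqν hf
    fun α => hbdd _ (hG0 α)
  obtain ⟨i4, e4⟩ := integral_comp_snd_mul_of_lintegral_eq_one hq (fun z => (hq0 z).le) hqμ hg
    fun ω => hbdd _ (hH0 ω)
  have hGpos' : ∀ᵐ z ∂(ν.prod μ), 0 < G z.1 :=
    Measure.quasiMeasurePreserving_fst.ae hGpos
  -- `D = (φ H - φ G) * (p - q)` integrates to zero because `p` and `q` have equal marginals; it is
  -- nonnegative because `p - q = q * (H - G) / G` and `φ` is increasing.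
  set D : A × Ω → ℝ := fun z => (H z.2 / (1 + H z.2) * p z - G z.1 / (1 + G z.1) * p z) -
    (H z.2 / (1 + H z.2) * q z - G z.1 / (1 + G z.1) * q z) with hD
  have hDint : Integrable D (ν.prod μ) := (i2.sub i1).sub (i4.sub i3)
  have hDzero : ∫ z, D z ∂(ν.prod μ) = 0 := by
    refine (integral_sub (i2.sub i1) (i4.sub i3)).trans ?_
    rw [integral_sub' i2 i1, integral_sub' i4 i3, e1, e2, e3, e4, sub_self]
  have hDeq : ∀ᵐ z ∂(ν.prod μ), D z =
      q z * (H z.2 - G z.1) ^ 2 / ((1 + H z.2) * (1 + G z.1) * G z.1) := by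
    filter_upwards [hGpos'] with z hz
    have := hH0 z.2
    have h1 : (1 + H z.2) ≠ 0 := by positivity
    have h2 : (1 + G z.1) ≠ 0 := by positivity
    simp only [hD, hp]
    field_simp
    ring
  have hDnonneg : 0 ≤ᵐ[ν.prod μ] D := by
    filter_upwards [hGpos', hDeq] with z hz hz'
    have := hH0 z.2
    have := hq0 z
    rw [hz', Pi.zero_apply]
    positivity
  filter_upwards [(integral_eq_zero_iff_of_nonneg_ae hDnonneg hDint).1 hDzero, hGpos', hDeq]
    with z h0 hz hz'
  have h1 := hH0 z.2
  have h2 := hq0 z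
  have h3 : (1 + H z.2) * (1 + G z.1) * G z.1 ≠ 0 := by positivity
  rw [hz', Pi.zero_apply, div_eq_zero_iff, or_iff_left h3, mul_eq_zero, or_iff_right h2.ne',
    sq_eq_zero_iff, sub_eq_zero] at h0
  exact h0.symm

end Coupling

/-! ### Schrödinger potentials and the Kuhn-Tucker condition. -/

section Potentials

variable {A Ω : Type*} [MeasurableSpace A] [MeasurableSpace Ω] {u : A → Ω → ℝ} {ubar lam : ℝ}
  {ν : Measure A} {μ : Measure Ω} [IsProbabilityMeasure ν] [IsProbabilityMeasure μ]
  {a : A → EReal} {b : Ω → EReal}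

lemma measurable_exp_div (hu : Measurable (Function.uncurry u)) :
    Measurable fun z : A × Ω => Real.exp (u z.1 z.2 / lam) :=
  (hu.div_const lam).exp

lemma integrable_exp_div (hu : Measurable (Function.uncurry u)) (hubar : ∀ α ω, u α ω ≤ ubar)
    (hlam : 0 < lam) (ω : Ω) : Integrable (fun α => Real.exp (u α ω / lam)) ν := by
  refine Integrable.of_bound (C := Real.exp (ubar / lam))
    ((measurable_exp_div hu).comp measurable_prodMk_right).aestronglyMeasurable
    (Filter.Eventually.of_forall fun α => ?_)
  rw [Real.norm_of_nonneg (Real.exp_pos _).le, Real.exp_le_exp]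
  exact div_le_div_of_nonneg_right (hubar α ω) hlam.le

lemma partitionFunction_pos (hu : Measurable (Function.uncurry u))
    (hubar : ∀ α ω, u α ω ≤ ubar) (hlam : 0 < lam) (ω : Ω) : 0 < partitionFunction u lam ν ω :=
  integral_exp_pos (integrable_exp_div hu hubar hlam ω)

lemma measurable_partitionFunction (hu : Measurable (Function.uncurry u)) :
    Measurable (partitionFunction u lam ν) :=
  (StronglyMeasurable.integral_prod_left (f := fun α ω => Real.exp (u α ω / lam))
    (measurable_exp_div hu).stronglyMeasurable).measurable

lemma ofReal_partitionFunction (hu : Measurable (Function.uncurry u))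
    (hubar : ∀ α ω, u α ω ≤ ubar) (hlam : 0 < lam) (ω : Ω) :
    ENNReal.ofReal (partitionFunction u lam ν ω) =
      ∫⁻ α, ENNReal.ofReal (Real.exp (u α ω / lam)) ∂ν :=
  ofReal_integral_eq_lintegral_ofReal (integrable_exp_div hu hubar hlam ω)
    (Filter.Eventually.of_forall fun _ => (Real.exp_pos _).le)

/-- In `[0, ∞]` the bound by `1` already forces integrability, and the integral can be compared
directly with `exp (a α)`. -/
lemma kuhnTucker_iff_lintegral (hu : Measurable (Function.uncurry u))
    (hubar : ∀ α ω, u α ω ≤ ubar) (hlam : 0 < lam) :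
    KuhnTucker u lam ν μ ↔
      (∀ α, ∫⁻ ω, ENNReal.ofReal (Real.exp (u α ω / lam) / partitionFunction u lam ν ω) ∂μ ≤ 1) ∧
      ∀ᵐ α ∂ν,
        ∫⁻ ω, ENNReal.ofReal (Real.exp (u α ω / lam) / partitionFunction u lam ν ω) ∂μ = 1 := by
  have hpos := partitionFunction_pos (ν := ν) hu hubar hlam
  have hnn : ∀ α ω, 0 ≤ Real.exp (u α ω / lam) / partitionFunction u lam ν ω :=
    fun α ω => div_nonneg (Real.exp_pos _).le (hpos ω).le
  have hmeas : ∀ α, Measurable fun ω => Real.exp (u α ω / lam) / partitionFunction u lam ν ω :=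
    fun α => ((measurable_exp_div hu).comp measurable_prodMk_left).div
      (measurable_partitionFunction hu)
  have hint : ∀ α, Integrable (kuhnTuckerIntegrand u lam ν α) μ ↔
      Integrable (fun ω => Real.exp (u α ω / lam) / partitionFunction u lam ν ω) μ := fun α =>
    integrable_add_const_iff (c := (-1 : ℝ))
      (f := fun ω => Real.exp (u α ω / lam) / partitionFunction u lam ν ω)
  have heq : ∀ α, Integrable (kuhnTuckerIntegrand u lam ν α) μ →
      ∫ ω, kuhnTuckerIntegrand u lam ν α ω ∂μ =
        (∫ ω, Real.exp (u α ω / lam) / partitionFunction u lam ν ω ∂μ) - 1 := fun α h => by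
    simp only [kuhnTuckerIntegrand]
    rw [integral_sub ((hint α).1 h) (integrable_const _)]
    simp
  have hl : ∀ α, Integrable (kuhnTuckerIntegrand u lam ν α) μ →
      ∫⁻ ω, ENNReal.ofReal (Real.exp (u α ω / lam) / partitionFunction u lam ν ω) ∂μ =
        ENNReal.ofReal (∫ ω, Real.exp (u α ω / lam) / partitionFunction u lam ν ω ∂μ) :=
    fun α h => (ofReal_integral_eq_lintegral_ofReal ((hint α).1 h)
      (Filter.Eventually.of_forall (hnn α))).symm
  have hfin : ∀ α,
      ∫⁻ ω, ENNReal.ofReal (Real.exp (u α ω / lam) / partitionFunction u lam ν ω) ∂μ ≤ 1 →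
      Integrable (kuhnTuckerIntegrand u lam ν α) μ := fun α h => by
    rw [hint]
    refine ⟨(hmeas α).aestronglyMeasurable, ?_⟩
    rw [hasFiniteIntegral_iff_ofReal (Filter.Eventually.of_forall (hnn α))]
    exact h.trans_lt ENNReal.one_lt_top
  constructor
  · rintro ⟨h1, h2⟩
    refine ⟨fun α => ?_, h2.mono fun α hα => ?_⟩
    · have := (h1 α).2
      rw [heq α (h1 α).1] at this
      rw [hl α (h1 α).1, ENNReal.ofReal_le_one]
      linarith
    · rw [heq α (h1 α).1] at hα
      rw [hl α (h1 α).1, ENNReal.ofReal_eq_one]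
      linarith
  · rintro ⟨h1, h2⟩
    refine ⟨fun α => ⟨hfin α (h1 α), ?_⟩, h2.mono fun α hα => ?_⟩
    · have := h1 α
      rw [hl α (hfin α (h1 α)), ENNReal.ofReal_le_one] at this
      rw [heq α (hfin α (h1 α))]
      linarith
    · rw [hl α (hfin α (h1 α)), ENNReal.ofReal_eq_one] at hα
      rw [heq α (hfin α (h1 α))]
      linarith

/-- If the action potential vanishes almost everywhere, then `exp b` is the partition function, so
`exp a` is given everywhere by the integral of the Kuhn-Tucker condition. -/
lemma IsSchrodingerPotentials.exp_action_of_ae_eq_zero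
    (hab : IsSchrodingerPotentials u lam ν μ a b) (hu : Measurable (Function.uncurry u))
    (hubar : ∀ α ω, u α ω ≤ ubar) (hlam : 0 < lam) (ha : ∀ᵐ α ∂ν, a α = 0) (α : A) :
    EReal.exp (a α) =
      ∫⁻ ω, ENNReal.ofReal (Real.exp (u α ω / lam) / partitionFunction u lam ν ω) ∂μ := by
  rw [hab.action_eq]
  refine lintegral_congr fun ω => ?_
  have hb : EReal.exp (b ω) = ENNReal.ofReal (partitionFunction u lam ν ω) := by
    rw [hab.state_eq, ofReal_partitionFunction hu hubar hlam]
    refine lintegral_congr_ae (ha.mono fun α' hα' => ?_)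
    simp only [hα', exp_coe_sub, EReal.exp_zero, inv_one, mul_one]
  rw [exp_coe_sub, hb, ENNReal.ofReal_div_of_pos (partitionFunction_pos hu hubar hlam ω)]
  exact (div_eq_mul_inv _ _).symm

/-- Under the equality part of the Kuhn-Tucker condition the action potential is almost everywhere
constant. -/
lemma IsSchrodingerPotentials.exists_ae_eq_const
    (hab : IsSchrodingerPotentials u lam ν μ a b) (hu : Measurable (Function.uncurry u))
    (hubar : ∀ α ω, u α ω ≤ ubar) (hlam : 0 < lam)
    (hKT : ∀ᵐ α ∂ν,
      ∫⁻ ω, ENNReal.ofReal (Real.exp (u α ω / lam) / partitionFunction u lam ν ω) ∂μ = 1) :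
    ∃ c : EReal, ∀ᵐ α ∂ν, a α = c := by
  have hZ := partitionFunction_pos (ν := ν) hu hubar hlam
  have hZm : Measurable (partitionFunction u lam ν) := measurable_partitionFunction hu
  -- Where a potential is infinite, `toReal` and division by zero give junk values that are still
  -- nonnegative; those points are null.
  set G : A → ℝ := fun α => (EReal.exp (a α)).toReal with hG
  set H : Ω → ℝ := fun ω => partitionFunction u lam ν ω / (EReal.exp (b ω)).toReal with hH
  set q : A × Ω → ℝ := fun z => Real.exp (u z.1 z.2 / lam) / partitionFunction u lam ν z.2 with hq
  have hfact : ∀ α ω, (a α ≠ ⊥ ∧ a α ≠ ⊤) → (b ω ≠ ⊥ ∧ b ω ≠ ⊤) →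
      ENNReal.ofReal (q (α, ω) * (H ω / G α)) = ENNReal.ofReal (Real.exp (u α ω / lam)) *
        (EReal.exp (a α))⁻¹ * (EReal.exp (b ω))⁻¹ := by
    intro α ω ha hb
    obtain ⟨ha0, ha1⟩ := exp_eq_ofReal_toReal ha
    obtain ⟨hb0, hb1⟩ := exp_eq_ofReal_toReal hb
    rw [ha1, hb1, ← ENNReal.ofReal_inv_of_pos ha0, ← ENNReal.ofReal_inv_of_pos hb0,
      ← ENNReal.ofReal_mul (Real.exp_pos _).le, ← ENNReal.ofReal_mul (by positivity)]
    congr 1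
    have := hZ ω
    simp only [hq, hH, hG]
    field_simp
  have hcancel : ∀ {y : EReal}, (y ≠ ⊥ ∧ y ≠ ⊤) → EReal.exp y * (EReal.exp y)⁻¹ = 1 := fun hy =>
    ENNReal.mul_inv_cancel (by simpa using hy.1) (by simpa using hy.2)
  have hinv : ∀ {y : EReal}, (y ≠ ⊥ ∧ y ≠ ⊤) → (EReal.exp y)⁻¹ ≠ ⊤ := fun hy => by
    simpa using hy.1
  have key : ∀ᵐ z ∂(ν.prod μ), G z.1 = H z.2 := by
    refine ae_eq_of_coupling_densities (p := fun z => q z * (H z.2 / G z.1)) (q := q)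
      ((measurable_exp_div hu).div (hZm.comp measurable_snd))
      (fun z => div_pos (Real.exp_pos _) (hZ _))
      hab.measurable_action.ereal_exp.ennreal_toReal
      (hZm.div hab.measurable_state.ereal_exp.ennreal_toReal)
      (fun _ => ENNReal.toReal_nonneg) (fun ω => div_nonneg (hZ ω).le ENNReal.toReal_nonneg)
      (hab.finite_action.mono fun α hα => (exp_eq_ofReal_toReal hα).1) (fun _ => rfl) ?_ ?_ hKT ?_
    · filter_upwards [hab.finite_action] with α hα
      rw [← hcancel hα]
      conv_rhs => enter [1]; rw [hab.action_eq α]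
      rw [← lintegral_mul_const' _ _ (hinv hα)]
      refine lintegral_congr_ae (hab.finite_state.mono fun ω hω => ?_)
      simp only [hfact α ω hα hω, exp_coe_sub]
      exact mul_right_comm _ _ _
    · filter_upwards [hab.finite_state] with ω hω
      rw [← hcancel hω]
      conv_rhs => enter [1]; rw [hab.state_eq ω]
      rw [← lintegral_mul_const' _ _ (hinv hω)]
      refine lintegral_congr_ae (hab.finite_action.mono fun α hα => ?_)
      simp only [hfact α ω hα hω, exp_coe_sub]
    -- This marginal of `q` is correct at every `ω` by the definition of `Z`.
    · refine Filter.Eventually.of_forall fun ω => ?_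
      have hZω : (ENNReal.ofReal (partitionFunction u lam ν ω))⁻¹ ≠ ⊤ := by simpa using hZ ω
      simp only [hq, ENNReal.ofReal_div_of_pos (hZ ω)]
      refine (lintegral_mul_const' _ _ hZω).trans ?_
      rw [← ofReal_partitionFunction hu hubar hlam]
      exact ENNReal.mul_inv_cancel (by simpa using hZ ω) ENNReal.ofReal_ne_top
  have key' : ∀ᵐ z ∂(μ.prod ν), G z.2 = H z.1 :=
    Measure.measurePreserving_swap.quasiMeasurePreserving.ae key
  -- One good slice suffices: there `G` equals the number `H ω` a.e.
  obtain ⟨ω, hω⟩ := (Measure.ae_ae_of_ae_prod key').exists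
  refine ⟨ENNReal.log (ENNReal.ofReal (H ω)), ?_⟩
  filter_upwards [hω, hab.finite_action] with α hα hα'
  rw [← hα, ← (exp_eq_ofReal_toReal hα').2, EReal.log_exp]

/-- Finiteness matters: `toReal` sends `⊥` and `⊤` to `0`, so the normalization alone would not
exclude them. -/
lemma ae_eq_zero_of_ae_eq_const {c : EReal} (hfin : ∀ᵐ α ∂ν, a α ≠ ⊥ ∧ a α ≠ ⊤)
    (hnorm : ∫ α, (a α).toReal ∂ν = 0) (hc : ∀ᵐ α ∂ν, a α = c) : ∀ᵐ α ∂ν, a α = 0 := by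
  have hc0 : c = 0 := by
    obtain ⟨α, hα, hα'⟩ := (hfin.and hc).exists
    rw [hα'] at hα
    have h : ∫ α, (a α).toReal ∂ν = c.toReal := by
      rw [integral_congr_ae (hc.mono fun α h => congrArg EReal.toReal h)]
      simp
    rw [← EReal.coe_toReal hα.2 hα.1, ← h, hnorm, EReal.coe_zero]
  exact hc0 ▸ hc

lemma isPlateau_iff {m : Measure A} [IsProbabilityMeasure m] (ha : Measurable a) :
    IsPlateau a m ↔ (∀ᵐ α ∂m, a α = essSup a m) ∧ ∀ α, a α ≤ essSup a m := by
  rw [IsPlateau, measure_univ]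
  exact and_congr_left' (mem_ae_iff_prob_eq_one (ha (measurableSet_singleton _))).symm

/-- A plateau is a.e. constant, so the normalization puts its height at zero. -/
lemma nonposWithEqualityAE_iff_isPlateau (ha : Measurable a)
    (hfin : ∀ᵐ α ∂ν, a α ≠ ⊥ ∧ a α ≠ ⊤) (hnorm : ∫ α, (a α).toReal ∂ν = 0) :
    NonposWithEqualityAE a ν ↔ IsPlateau a ν := by
  have hess : (∀ᵐ α ∂ν, a α = 0) → essSup a ν = 0 := fun h => by
    rw [essSup_congr_ae (g := fun _ => (0 : EReal)) h,
      essSup_const _ (IsProbabilityMeasure.ne_zero ν)]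
  rw [isPlateau_iff ha]
  constructor
  · rintro ⟨h1, h2⟩
    rw [hess h2]
    exact ⟨h2, h1⟩
  · rintro ⟨h1, h2⟩
    have h0 := ae_eq_zero_of_ae_eq_const hfin hnorm h1
    rw [hess h0] at h2
    exact ⟨h2, h0⟩

lemma IsSchrodingerPotentials.kuhnTucker_iff (hab : IsSchrodingerPotentials u lam ν μ a b)
    (hu : Measurable (Function.uncurry u)) (hubar : ∀ α ω, u α ω ≤ ubar) (hlam : 0 < lam)
    (hnorm : ∫ α, (a α).toReal ∂ν = 0) :
    KuhnTucker u lam ν μ ↔ NonposWithEqualityAE a ν := by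
  have hone : ∀ {y : EReal}, EReal.exp y = 1 ↔ y = 0 := fun {y} => by
    rw [← EReal.exp_zero, EReal.exp_strictMono.injective.eq_iff]
  rw [kuhnTucker_iff_lintegral hu hubar hlam]
  constructor
  · rintro ⟨h1, h2⟩
    obtain ⟨c, hc⟩ := hab.exists_ae_eq_const hu hubar hlam h2
    have h0 := ae_eq_zero_of_ae_eq_const hab.finite_action hnorm hc
    refine ⟨fun α => ?_, h0⟩
    rw [← EReal.exp_le_one_iff, hab.exp_action_of_ae_eq_zero hu hubar hlam h0]
    exact h1 α
  · rintro ⟨h1, h0⟩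
    simp only [← hab.exp_action_of_ae_eq_zero hu hubar hlam h0]
    exact ⟨fun α => EReal.exp_le_one_iff.2 (h1 α), h0.mono fun α hα => hone.2 hα⟩

end Potentials

end RationalInattention

theorem mainTheorem10
    {A Ω : Type*}
    [TopologicalSpace A] [PolishSpace A] [MeasurableSpace A] [BorelSpace A]
    [TopologicalSpace Ω] [PolishSpace Ω] [MeasurableSpace Ω] [BorelSpace Ω]
    (u : A → Ω → ℝ) (hu : Measurable (Function.uncurry u))
    (ubar : ℝ) (hubar : ∀ α ω, u α ω ≤ ubar)
    (lam : ℝ) (hlam : 0 < lam)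
    (ν : MeasureTheory.Measure A) [MeasureTheory.IsProbabilityMeasure ν]
    (μ : MeasureTheory.Measure Ω) [MeasureTheory.IsProbabilityMeasure μ]
    (a : A → EReal) (b : Ω → EReal)
    (hab : RationalInattention.IsSchrodingerPotentials u lam ν μ a b)
    (ha_int : MeasureTheory.Integrable (fun α => (a α).toReal) ν)
    (ha_norm : ∫ α, (a α).toReal ∂ν = 0) :
    (RationalInattention.KuhnTucker u lam ν μ ↔ RationalInattention.NonposWithEqualityAE a ν) ∧
      (RationalInattention.NonposWithEqualityAE a ν ↔ RationalInattention.IsPlateau a ν) := by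
  exact ⟨hab.kuhnTucker_iff hu hubar hlam ha_norm,
    RationalInattention.nonposWithEqualityAE_iff_isPlateau hab.measurable_action hab.finite_action
      ha_norm⟩
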